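/- Let $\mathcal M$ be a finite-dimensional smooth Riemannian manifold (without boundary) with exponential map $\mathrm{Exp}$, and let $\Omega\subseteq\mathcal M$ be geodesically uniquely convex: for all $x,y\in\Omega$ there is exactly one geodesic $\gamma:[0,1]\to\mathcal M$ with $\gamma(0)=x$, $\gamma(1)=y$ and $\gamma([0,1])\subseteq\Omega$. Write $\mathrm{Exp}_x^{-1}(y):=\gamma'(0)\in T_x\mathcal M$ for this geodesic, and let $\mathcal D_x\subseteq T_x\mathcal M$ be the set of all $v$ such that $t\mapsto \mathrm{Exp}_x(tv)$ is defined and stays in $\Omega$ for $t\in[0,1]$. Let $f,h:\mathcal M\to\mathbb R$, $F=f+h$, and let $L>0$, $\mu\ge 0$, $\rho\in\mathbb R$, $\theta\ge 1$. Assume: (a) $f$ is differentiable at every point of $\Omega$, and for all $x,y\in\Omega$ $$\bigl|f(y)-f(x)-\langle \operatorname{grad} f(x),\mathrm{Exp}_x^{-1}(y)\rangle\bigr|\le \tfrac L2\|\mathrm{Exp}_x^{-1}(y)\|^2$$ (geodesic $L$-smoothness) and $$f(y)\ge f(x)+\langle \operatorname{grad} f(x),\mathrm{Exp}_x^{-1}(y)\rangle+\tfrac\mu2\|\mathrm{Exp}_x^{-1}(y)\|^2$$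 (geodesic $\mu$-strong convexity; geodesic convexity if $\mu=0$). (b) Every point of $\Omega$ has a neighbourhood in $\mathcal M$ on which $h$ is Lipschitz, and $h$ is $\rho$-retraction-convex in $\Omega$ with respect to $\mathrm{Exp}$: for every $x\in\Omega$ and every $U\subseteq\mathcal D_x$ (so that $\mathrm{Exp}_x(U)\subseteq\Omega$), the function $\tilde h_x(\eta)=h(\mathrm{Exp}_x(\eta))+\frac\rho2\|\eta\|^2$ satisfies $$\tilde h_x(\eta)\ge\tilde h_x(\omega)+\langle v,\eta-\omega\rangle\qquad\text{for all }\eta,\omega\in U\text{ and all }v\in\partial\tilde h_x(\omega),$$ where $\partial$ is the Clarke generalized subdifferential on the Euclidean space $T_x\mathcal M$. Let $y\in\Omega$ and $$\ell_y(\eta)=\langle\operatorname{grad} f(y),\eta\rangle+\tfrac{\theta L}{2}\|\eta\|^2+h(\mathrm{Exp}_y(\eta)).$$ Let $\eta_y\in T_y\mathcal M$ be a stationary point of $\ell_y$, i.e. $0\in\partial\ell_y(\eta_y)$ (for instance a local minimizer), with $\ell_y(0)\ge\ell_y(\eta_y)$. Suppose that $z=\mathrm{Exp}_y(\eta_y)$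 lies in $\Omega$ and that $\eta_y=\mathrm{Exp}_y^{-1}(z)$. Then for all $x\in\Omega$ $$F(x)-F(z)\ \ge\ \frac{\theta L-\rho}{2}\,\bigl\|\mathrm{Exp}_y^{-1}(x)-\eta_y\bigr\|^2-\frac{\theta L-\mu}{2}\,\bigl\|\mathrm{Exp}_y^{-1}(x)\bigr\|^2 .$$ -/

import Mathlib

open Set Filter Topology Bundle
open scoped Manifold ContDiff NNReal InnerProductSpace

noncomputable section

namespace RiemProx

/-! ### Clarke subdifferential on a real inner product space -/

section Clarke

variable {V : Type*} [NormedAddCommGroup V] [InnerProductSpace ℝ V]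

/-- Clarke's generalized directional derivative
`φ°(a; v) = limsup_{b → a, t ↓ 0} (φ (b + t v) - φ b) / t`, with values in `[-∞, ∞]`. -/
def clarkeDeriv (φ : V → ℝ) (a v : V) : EReal :=
  limsup (fun p : V × ℝ => (((φ (p.1 + p.2 • v) - φ p.1) / p.2 : ℝ) : EReal))
    (𝓝 a ×ˢ 𝓝[>] (0 : ℝ))

/-- The Clarke generalized subdifferential of `φ` at `a`. -/
def clarkeSubdiff (φ : V → ℝ) (a : V) : Set V :=
  {g | ∀ v : V, ((⟪g, v⟫_ℝ : ℝ) : EReal) ≤ clarkeDeriv φ a v}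

end Clarke

section Riemannian

variable {E : Type*} [NormedAddCommGroup E] [NormedSpace ℝ E]
  {M : Type*} [EMetricSpace M] [ChartedSpace E M]

/-! ### Geodesics -/

section Geodesics

variable [RiemannianBundle (fun x : M => TangentSpace 𝓘(ℝ, E) x)]

/-- The metric read in the preferred chart at `p`: the value at the point `u` of the chart target,
on the coordinate vectors `v`, `w`, of the pull-back of the metric by the inverse chart. -/
def chartMetric (p : M) (u v w : E) : ℝ :=
  inner ℝ (mfderiv 𝓘(ℝ, E) 𝓘(ℝ, E) (extChartAt 𝓘(ℝ, E) p).symm u v)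
    (mfderiv 𝓘(ℝ, E) 𝓘(ℝ, E) (extChartAt 𝓘(ℝ, E) p).symm u w)

/-- Christoffel symbols of the first kind in the chart at `p`:
`Γ_u(v, w; ξ) = (∂_v g(w, ξ) + ∂_w g(v, ξ) - ∂_ξ g(v, w)) / 2`. -/
def christoffelFirst (p : M) (u v w ξ : E) : ℝ :=
  (fderiv ℝ (fun u' => chartMetric p u' w ξ) u v
    + fderiv ℝ (fun u' => chartMetric p u' v ξ) u w
    - fderiv ℝ (fun u' => chartMetric p u' v w) u ξ) / 2

/-- `γ` is a geodesic near the time `t₀`: it is smooth there and, in the chart at `γ t₀`, its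
coordinate expression `c` satisfies the geodesic equation (zero covariant acceleration, with the
index lowered by the metric) `g(c'', ξ) + Γ(c', c'; ξ) = 0` for all `ξ`, at all times near `t₀`. -/
def IsGeodesicAt (γ : ℝ → M) (t₀ : ℝ) : Prop :=
  ContMDiffAt 𝓘(ℝ, ℝ) 𝓘(ℝ, E) ∞ γ t₀ ∧
  ∀ᶠ t in 𝓝 t₀, ∀ ξ : E,
    let c : ℝ → E := fun s => extChartAt 𝓘(ℝ, E) (γ t₀) (γ s)
    chartMetric (γ t₀) (c t) (deriv (deriv c) t) ξ
      + christoffelFirst (γ t₀) (c t) (deriv c t) (deriv c t) ξ = 0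

/-- `γ` restricts to a geodesic `[0, 1] → M`. (Only the values on a neighbourhood of `[0, 1]`
matter; geodesics on `[0, 1]` extend slightly beyond the end points.) -/
def IsUnitGeodesic (γ : ℝ → M) : Prop :=
  ∀ t ∈ Icc (0 : ℝ) 1, IsGeodesicAt (E := E) γ t

/-- `Ω` is geodesically uniquely convex: any two of its points are joined by exactly one geodesic
`[0, 1] → M` that stays in `Ω`. -/
def IsGeodesicallyUniquelyConvex (E : Type*) [NormedAddCommGroup E] [NormedSpace ℝ E]
    {M : Type*} [EMetricSpace M] [ChartedSpace E M]
    [RiemannianBundle (fun x : M => TangentSpace 𝓘(ℝ, E) x)] (Ω : Set M) : Prop :=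
  ∀ x ∈ Ω, ∀ y ∈ Ω,
    (∃ γ : ℝ → M, IsUnitGeodesic (E := E) γ ∧ γ 0 = x ∧ γ 1 = y ∧ MapsTo γ (Icc 0 1) Ω) ∧
    ∀ γ₁ γ₂ : ℝ → M,
      IsUnitGeodesic (E := E) γ₁ → γ₁ 0 = x → γ₁ 1 = y → MapsTo γ₁ (Icc 0 1) Ω →
      IsUnitGeodesic (E := E) γ₂ → γ₂ 0 = x → γ₂ 1 = y → MapsTo γ₂ (Icc 0 1) Ω →
      EqOn γ₁ γ₂ (Icc 0 1)

end Geodesics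

/-! ### The exponential map and its inverse on `Ω` -/

/-- The point `γ t` together with the velocity `γ' t`, as an element of the tangent bundle. -/
def velocity (γ : ℝ → M) (t : ℝ) : TangentBundle 𝓘(ℝ, E) M :=
  ⟨γ t, mfderiv 𝓘(ℝ, ℝ) 𝓘(ℝ, E) γ t (1 : ℝ)⟩

variable [RiemannianBundle (fun x : M => TangentSpace 𝓘(ℝ, E) x)]

open Classical in
/-- The exponential map: `Exp_x(v) = γ(1)` for the geodesic `γ : [0, 1] → M` with `γ(0) = x` and
`γ'(0) = v`. If there is no such geodesic (possible only when `M` is not complete), the value is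
the irrelevant point `x`. -/
def expMap (x : M) (v : TangentSpace 𝓘(ℝ, E) x) : M :=
  if h : ∃ γ : ℝ → M, IsUnitGeodesic (E := E) γ ∧ velocity (E := E) γ 0 = ⟨x, v⟩ then
    h.choose 1
  else x

/-- The set of tangent vectors `v` at `x` such that `t ↦ Exp_x(t v)`, `t ∈ [0, 1]`, is a geodesic
staying in `Ω`. -/
def expDomain (Ω : Set M) (x : M) : Set (TangentSpace 𝓘(ℝ, E) x) :=
  {v | ∃ γ : ℝ → M, IsUnitGeodesic (E := E) γ ∧ velocity (E := E) γ 0 = ⟨x, v⟩ ∧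
    MapsTo γ (Icc 0 1) Ω}

open Classical in
/-- The inverse exponential map `Exp_x⁻¹(y)` of a geodesically uniquely convex set `Ω`: the initial
velocity of the geodesic in `Ω` from `x` to `y` (and `0` if there is none). -/
def logMap (Ω : Set M) (x y : M) : TangentSpace 𝓘(ℝ, E) x :=
  if h : ∃ v : TangentSpace 𝓘(ℝ, E) x, ∃ γ : ℝ → M, IsUnitGeodesic (E := E) γ ∧
      velocity (E := E) γ 0 = ⟨x, v⟩ ∧ γ 1 = y ∧ MapsTo γ (Icc 0 1) Ω then
    h.choose
  else 0

/-! ### Gradient, smoothness and convexity -/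

/-- `h` is locally Lipschitz in `Ω`: every point of `Ω` has a neighbourhood in `M` on which `h` is
Lipschitz for the Riemannian distance. -/
def IsLocallyLipschitzIn (h : M → ℝ) (Ω : Set M) : Prop :=
  ∀ x ∈ Ω, ∃ K : ℝ≥0, ∃ s ∈ 𝓝 x, LipschitzOnWith K h s

/-- A retraction `R`, where `R_x` is used on the set `𝒟 x ⊆ T_x M`, being given, `h` is
`ρ`-retraction-convex in `Ω`: for all `x ∈ Ω` and all `U ⊆ 𝒟 x` with `R_x(U) ⊆ Ω`, every
subgradient `v` at `w ∈ U` of `h̃_x = h ∘ R_x + (ρ / 2) ‖·‖²` supports `h̃_x` on `U`. -/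
def IsRetractionConvex (R : (x : M) → TangentSpace 𝓘(ℝ, E) x → M)
    (𝒟 : (x : M) → Set (TangentSpace 𝓘(ℝ, E) x)) (ρ : ℝ) (h : M → ℝ) (Ω : Set M) : Prop :=
  ∀ x ∈ Ω, ∀ U : Set (TangentSpace 𝓘(ℝ, E) x), U ⊆ 𝒟 x → MapsTo (R x) U Ω →
    ∀ η ∈ U, ∀ w ∈ U,
      ∀ v ∈ clarkeSubdiff (fun ζ : TangentSpace 𝓘(ℝ, E) x => h (R x ζ) + ρ / 2 * ‖ζ‖ ^ 2) w,
        h (R x w) + ρ / 2 * ‖w‖ ^ 2 + ⟪v, η - w⟫_ℝ ≤ h (R x η) + ρ / 2 * ‖η‖ ^ 2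

variable [FiniteDimensional ℝ E]

instance instFiniteDimensionalTangent (x : M) :
    FiniteDimensional ℝ (TangentSpace 𝓘(ℝ, E) x) :=
  inferInstanceAs (FiniteDimensional ℝ E)

instance instCompleteTangent (x : M) : CompleteSpace (TangentSpace 𝓘(ℝ, E) x) :=
  FiniteDimensional.complete ℝ _

/-- The Riemannian gradient: `⟪grad f x, v⟫ = df_x(v)`. -/
def grad (f : M → ℝ) (x : M) : TangentSpace 𝓘(ℝ, E) x :=
  (InnerProductSpace.toDual ℝ (TangentSpace 𝓘(ℝ, E) x)).symm (mvfderiv 𝓘(ℝ, E) f x)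

/-- `f` is geodesically `μ`-strongly convex on `Ω` (geodesically convex if `μ = 0`). -/
def IsGeodesicallyStronglyConvex (E : Type*) [NormedAddCommGroup E] [NormedSpace ℝ E]
    [FiniteDimensional ℝ E] {M : Type*} [EMetricSpace M] [ChartedSpace E M]
    [RiemannianBundle (fun x : M => TangentSpace 𝓘(ℝ, E) x)]
    (μ : ℝ) (f : M → ℝ) (Ω : Set M) : Prop :=
  ∀ x ∈ Ω, ∀ y ∈ Ω,
    f x + ⟪grad (E := E) f x, logMap Ω x y⟫_ℝ + μ / 2 * ‖logMap (E := E) Ω x y‖ ^ 2 ≤ f y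

/-- `f` is geodesically `L`-smooth on `Ω`. -/
def IsGeodesicallySmooth (E : Type*) [NormedAddCommGroup E] [NormedSpace ℝ E]
    [FiniteDimensional ℝ E] {M : Type*} [EMetricSpace M] [ChartedSpace E M]
    [RiemannianBundle (fun x : M => TangentSpace 𝓘(ℝ, E) x)]
    (L : ℝ) (f : M → ℝ) (Ω : Set M) : Prop :=
  ∀ x ∈ Ω, ∀ y ∈ Ω,
    |f y - f x - ⟪grad (E := E) f x, logMap Ω x y⟫_ℝ| ≤ L / 2 * ‖logMap (E := E) Ω x y‖ ^ 2

/-- The objective of the Riemannian proximal subproblem at `y`,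
`ℓ_y(η) = ⟪grad f(y), η⟫ + (θ L / 2) ‖η‖² + h(Exp_y(η))`. -/
def proxModel (θ L : ℝ) (f h : M → ℝ) (y : M) (η : TangentSpace 𝓘(ℝ, E) y) : ℝ :=
  ⟪grad f y, η⟫_ℝ + θ * L / 2 * ‖η‖ ^ 2 + h (expMap y η)

end Riemannian

end RiemProx

end

/-!
The estimate combines three inequalities at `y`, with `ξ = Exp_y⁻¹(x)`. Strong convexity of `f`
bounds `f x` from below, smoothness bounds `f z` from above, and retraction-convexity bounds
`h x - h z` from below once a Clarke subgradient of `h̃_y = h ∘ Exp_y + (ρ / 2) ‖·‖²` at `η` is known.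
The proximal model `ℓ_y` differs from `h̃_y` by the smooth function `⟪grad f y, ·⟫ + (θL - ρ)/2 ‖·‖²`,
so stationarity of `η` yields the subgradient `-(grad f y + (θL - ρ) η)`
(`neg_add_smul_mem_clarkeSubdiff`). Summing up, the claim holds with the slack
`(θ - 1) L ‖η‖² / 2 ≥ 0`.

Retraction-convexity speaks of `h (Exp_y ξ)`, so it must be known that `Exp_y (Exp_y⁻¹ x) = x`. As
`expMap` and `logMap` choose their geodesics independently, this is the uniqueness of the geodesic
with a given initial velocity (`IsUnitGeodesic.eqOn`, `expMap_eq`). Locally, in a chart, the geodesic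
equation reads `G(c) c'' + Γ(c, c') = 0` with `G(u)` an invertible map from `E` to its dual
depending smoothly on `u`, hence is an ODE `c'' = -G(c)⁻¹ Γ(c, c')` with a locally Lipschitz
right-hand side (`eventuallyEq_of_implicit_second_order`, `IsGeodesicAt.eventuallyEq`).
The set of times near which two geodesics agree is thus open and closed in `[0, 1]`.
-/

namespace RiemProx

/-! ### Clarke subgradients of smooth perturbations -/

section Clarke

variable {V : Type*} [NormedAddCommGroup V] [InnerProductSpace ℝ V]

theorem tendsto_slope_of_hasStrictFDerivAt {q : V → ℝ} {a g : V}
    (hq : HasStrictFDerivAt q (innerSL ℝ g) a) (v : V) :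
    Tendsto (fun p : V × ℝ => (q (p.1 + p.2 • v) - q p.1) / p.2)
      (𝓝 a ×ˢ 𝓝[>] (0 : ℝ)) (𝓝 ⟪g, v⟫_ℝ) := by
  have hfst : Tendsto (fun p : V × ℝ => p.1) (𝓝 a ×ˢ 𝓝[>] (0 : ℝ)) (𝓝 a) := tendsto_fst
  have hsnd : Tendsto (fun p : V × ℝ => p.2) (𝓝 a ×ˢ 𝓝[>] (0 : ℝ)) (𝓝 0) :=
    tendsto_nhds_of_tendsto_nhdsWithin tendsto_snd
  have hlim : Tendsto (fun p : V × ℝ => (p.1 + p.2 • v, p.1))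
      (𝓝 a ×ˢ 𝓝[>] (0 : ℝ)) (𝓝 (a, a)) := by
    have h := (hfst.add (hsnd.smul_const v)).prodMk_nhds hfst
    simpa using h
  have hpos : ∀ᶠ p : V × ℝ in 𝓝 a ×ˢ 𝓝[>] (0 : ℝ), 0 < p.2 :=
    tendsto_snd.eventually self_mem_nhdsWithin
  have ho := (hasStrictFDerivAt_iff_isLittleO.1 hq).comp_tendsto hlim
  have ho' : (fun p : V × ℝ => q (p.1 + p.2 • v) - q p.1 - p.2 * ⟪g, v⟫_ℝ)
      =o[𝓝 a ×ˢ 𝓝[>] (0 : ℝ)] fun p => p.2 := by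
    refine (ho.congr_left fun p => ?_).trans_isBigO ?_
    · simp [inner_smul_right]
    · refine Asymptotics.IsBigO.of_bound ‖v‖ (Eventually.of_forall fun p => ?_)
      simp [norm_smul, mul_comm]
  have h0 := ho'.tendsto_div_nhds_zero.add_const ⟪g, v⟫_ℝ
  rw [zero_add] at h0
  refine h0.congr' ?_
  filter_upwards [hpos] with p hp
  field_simp
  ring

/-- Only the inclusion `∂(φ + q) a ⊆ ∂φ a + {∇q a}` for strictly differentiable `q` is needed. It holds
without any Lipschitz assumption on `φ`: the difference quotients of `q` converge, so the limsup is
subadditive without an indeterminate `∞ - ∞`. -/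
theorem sub_mem_clarkeSubdiff {φ q : V → ℝ} {a g s : V}
    (hq : HasStrictFDerivAt q (innerSL ℝ g) a)
    (hs : s ∈ clarkeSubdiff (fun x => φ x + q x) a) : s - g ∈ clarkeSubdiff φ a := by
  intro v
  have hlim : limsup (fun p : V × ℝ => (((q (p.1 + p.2 • v) - q p.1) / p.2 : ℝ) : EReal))
      (𝓝 a ×ˢ 𝓝[>] (0 : ℝ)) = ((⟪g, v⟫_ℝ : ℝ) : EReal) :=
    ((continuous_coe_real_ereal.tendsto _).comp
      (tendsto_slope_of_hasStrictFDerivAt hq v)).limsup_eq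
  have hle : clarkeDeriv (fun x => φ x + q x) a v ≤
      clarkeDeriv φ a v + ((⟪g, v⟫_ℝ : ℝ) : EReal) := by
    rw [← hlim]
    refine le_of_eq_of_le ?_ (EReal.limsup_add_le (.inr ?_) (.inr ?_))
    · unfold clarkeDeriv
      congr 1
      ext p
      rw [Pi.add_apply, ← EReal.coe_add]
      congr 1
      ring
    · rw [hlim]; exact EReal.coe_ne_top _
    · rw [hlim]; exact EReal.coe_ne_bot _
  rw [inner_sub_left, EReal.coe_sub]
  exact EReal.sub_le_of_le_add ((hs v).trans hle)

theorem hasStrictFDerivAt_inner_add_sq (g a : V) (c : ℝ) :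
    HasStrictFDerivAt (fun ζ : V => ⟪g, ζ⟫_ℝ + c / 2 * ‖ζ‖ ^ 2) (innerSL ℝ (g + c • a)) a := by
  have h := (innerSL ℝ g).hasStrictFDerivAt.add
    ((hasStrictFDerivAt_norm_sq a).const_mul (c / 2))
  refine (h.congr_fderiv ?_)
  ext v
  simp
  ring

/-- A stationary point `a` of the proximal model `⟪g, ·⟫ + c / 2 ‖·‖² + φ` provides an explicit
subgradient of the convexified function `φ + ρ / 2 ‖·‖²`. -/
theorem neg_add_smul_mem_clarkeSubdiff {φ : V → ℝ} {g a : V} {c ρ : ℝ}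
    (h : (0 : V) ∈ clarkeSubdiff (fun ζ => ⟪g, ζ⟫_ℝ + c / 2 * ‖ζ‖ ^ 2 + φ ζ) a) :
    -(g + (c - ρ) • a) ∈ clarkeSubdiff (fun ζ => φ ζ + ρ / 2 * ‖ζ‖ ^ 2) a := by
  rw [← zero_sub]
  refine sub_mem_clarkeSubdiff (hasStrictFDerivAt_inner_add_sq g a (c - ρ)) ?_
  convert h using 2
  ext ζ
  ring

end Clarke

/-! ### Uniqueness for implicit second-order equations -/

section ODE

variable {E : Type*} [NormedAddCommGroup E] [NormedSpace ℝ E] [FiniteDimensional ℝ E]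

set_option synthInstance.maxHeartbeats 200000 in
/-- Local uniqueness for `G(c) c'' + Γ(c, c') = 0`, where `G(u) : E → E*` is injective, hence
invertible because `E` is finite-dimensional. Smoothness of `Γ` is asked only after evaluation at
each `ξ`. -/
theorem eventuallyEq_of_implicit_second_order {T : Set E} (hT : IsOpen T)
    {G : E → E →L[ℝ] E →L[ℝ] ℝ} (hG : ContDiffOn ℝ ∞ G T)
    (hinj : ∀ u ∈ T, Function.Injective (G u))
    {Γ : E → E → E →L[ℝ] ℝ}
    (hΓ : ∀ ξ, ContDiffOn ℝ ∞ (fun p : E × E => Γ p.1 p.2 ξ) (T ×ˢ univ))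
    {c₁ c₂ : ℝ → E} {t₀ : ℝ} (hc₁ : ContDiffAt ℝ 2 c₁ t₀) (hc₂ : ContDiffAt ℝ 2 c₂ t₀)
    (h₁ : ∀ᶠ t in 𝓝 t₀, ∀ ξ, G (c₁ t) (deriv (deriv c₁) t) ξ + Γ (c₁ t) (deriv c₁ t) ξ = 0)
    (h₂ : ∀ᶠ t in 𝓝 t₀, ∀ ξ, G (c₂ t) (deriv (deriv c₂) t) ξ + Γ (c₂ t) (deriv c₂ t) ξ = 0)
    (hmem : c₁ t₀ ∈ T) (h0 : c₁ t₀ = c₂ t₀) (h0' : deriv c₁ t₀ = deriv c₂ t₀) :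
    c₁ =ᶠ[𝓝 t₀] c₂ := by
  have : CompleteSpace E := FiniteDimensional.complete ℝ E
  have hinv : ∀ u ∈ T, (G u).IsInvertible := by
    intro u hu
    have hfr : Module.finrank ℝ E = Module.finrank ℝ (E →L[ℝ] ℝ) := by
      rw [← (LinearMap.toContinuousLinearMap (𝕜 := ℝ) (E := E) (F' := ℝ)).finrank_eq]
      exact (Subspace.dual_finrank_eq (K := ℝ) (V := E)).symm
    refine ⟨(LinearEquiv.ofInjectiveOfFinrankEq
      (G u : E →ₗ[ℝ] E →L[ℝ] ℝ) (hinj u hu) hfr).toContinuousLinearEquiv, ?_⟩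
    ext v w
    rfl
  -- The equivalent first-order system for the pair `(c, c')`.
  let F : E × E → E × E := fun p => (p.2, -(G p.1).inverse (Γ p.1 p.2))
  have hTn : T ×ˢ (univ : Set E) ∈ 𝓝 (c₁ t₀, deriv c₁ t₀) :=
    (hT.prod isOpen_univ).mem_nhds ⟨hmem, mem_univ _⟩
  have hF : ContDiffAt ℝ 1 F (c₁ t₀, deriv c₁ t₀) := by
    have hΓ' : ContDiffAt ℝ ∞ (fun p : E × E => Γ p.1 p.2) (c₁ t₀, deriv c₁ t₀) :=
      (contDiffOn_clm_apply.2 hΓ).contDiffAt hTn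
    have hG' : ContDiffAt ℝ ∞ (fun p : E × E => G p.1) (c₁ t₀, deriv c₁ t₀) :=
      (hG.contDiffAt (hT.mem_nhds hmem)).comp (c₁ t₀, deriv c₁ t₀) contDiffAt_fst
    have hI : ContDiffAt ℝ ∞ (fun p : E × E => (G p.1).inverse) (c₁ t₀, deriv c₁ t₀) :=
      ContDiffAt.comp (g := ContinuousLinearMap.inverse) (c₁ t₀, deriv c₁ t₀)
        (hinv _ hmem).contDiffAt_map_inverse hG'
    exact (contDiffAt_snd.prodMk (hI.clm_apply hΓ').neg).of_le (by norm_cast)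
  obtain ⟨K, s, hs, hK⟩ := hF.exists_lipschitzOnWith
  have key : ∀ c : ℝ → E, ContDiffAt ℝ 2 c t₀ →
      (∀ᶠ t in 𝓝 t₀, ∀ ξ, G (c t) (deriv (deriv c) t) ξ + Γ (c t) (deriv c t) ξ = 0) →
      c t₀ = c₁ t₀ → deriv c t₀ = deriv c₁ t₀ →
      ∀ᶠ t in 𝓝 t₀, HasDerivAt (fun t => (c t, deriv c t)) (F (c t, deriv c t)) t ∧
        (c t, deriv c t) ∈ s := by
    intro c hc hode hc0 hc0'
    have hd : ContDiffAt ℝ 1 (deriv c) t₀ :=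
      (hc.fderiv_right (m := 1) (by norm_num)).clm_apply contDiffAt_const
    have hcont : ContinuousAt (fun t => (c t, deriv c t)) t₀ :=
      hc.continuousAt.prodMk hd.continuousAt
    have hs' : s ∩ T ×ˢ univ ∈ 𝓝 (c t₀, deriv c t₀) := by
      rw [hc0, hc0']; exact inter_mem hs hTn
    filter_upwards [hode, hcont hs', hc.eventually (by simp), hd.eventually (by simp)]
      with t ht hts hct hdt
    refine ⟨?_, hts.1⟩
    have hacc : deriv (deriv c) t = -(G (c t)).inverse (Γ (c t) (deriv c t)) := by
      have hGt : G (c t) (deriv (deriv c) t) = -Γ (c t) (deriv c t) := by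
        ext ξ
        have := ht ξ
        simp only [neg_apply]
        linarith
      rw [← map_neg, ← hGt, (hinv _ hts.2.1).inverse_apply_self]
    have h := (hct.differentiableAt (by simp)).hasDerivAt.prodMk
      (hdt.differentiableAt (by simp)).hasDerivAt
    rwa [hacc] at h
  have h := ODE_solution_unique_of_eventually (v := fun _ => F) (s := fun _ => s)
    (Eventually.of_forall fun _ => hK) (key c₁ hc₁ h₁ rfl rfl)
    (key c₂ hc₂ h₂ h0.symm h0'.symm) (by rw [h0, h0'])
  exact h.mono fun t ht => congrArg Prod.fst ht

end ODE

/-! ### The metric and the Christoffel symbols in a chart -/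

section ChartMetric

variable {E : Type*} [NormedAddCommGroup E] [NormedSpace ℝ E]
  {M : Type*} [EMetricSpace M] [ChartedSpace E M]
  [RiemannianBundle (fun x : M => TangentSpace 𝓘(ℝ, E) x)]

theorem contDiffOn_chartMetric [IsManifold 𝓘(ℝ, E) ∞ M]
    [IsContMDiffRiemannianBundle 𝓘(ℝ, E) ∞ E (fun x : M => TangentSpace 𝓘(ℝ, E) x)]
    (p : M) (v w : E) :
    ContDiffOn ℝ ∞ (fun u => chartMetric p u v w) (extChartAt 𝓘(ℝ, E) p).target := by
  have hopen : IsOpen (extChartAt 𝓘(ℝ, E) p).target := isOpen_extChartAt_target p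
  have hsec : ∀ v : E, ContMDiffOn 𝓘(ℝ, E) (𝓘(ℝ, E).prod 𝓘(ℝ, E)) ∞
      (fun u : E => (⟨(extChartAt 𝓘(ℝ, E) p).symm u,
        mfderiv 𝓘(ℝ, E) 𝓘(ℝ, E) (extChartAt 𝓘(ℝ, E) p).symm u v⟩ : TangentBundle 𝓘(ℝ, E) M))
      (extChartAt 𝓘(ℝ, E) p).target := by
    intro v
    have h := (contMDiffOn_extChartAt_symm (I := 𝓘(ℝ, E)) (n := ∞) p).contMDiffOn_tangentMapWithin
      (m := ∞) (by simp) hopen.uniqueMDiffOn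
    have hv : ContMDiff 𝓘(ℝ, E) (𝓘(ℝ, E).prod 𝓘(ℝ, E)) ∞
        (fun u : E => (⟨u, v⟩ : TangentBundle 𝓘(ℝ, E) E)) := by
      intro u
      rw [contMDiffAt_totalSpace]
      refine ⟨contMDiffAt_id, ?_⟩
      simpa using contMDiffAt_const
    refine (h.comp hv.contMDiffOn (fun u hu => hu)).congr fun u hu => ?_
    simp only [Function.comp_apply, tangentMapWithin, mfderivWithin_of_isOpen hopen hu]
  have h : ContMDiffOn 𝓘(ℝ, E) 𝓘(ℝ) ∞ (fun u => chartMetric p u v w)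
      (extChartAt 𝓘(ℝ, E) p).target :=
    ContMDiffOn.inner_bundle (IB := 𝓘(ℝ, E)) (F := E)
      (E := fun x : M => TangentSpace 𝓘(ℝ, E) x) (hsec v) (hsec w)
  exact h.contDiffOn

variable [FiniteDimensional ℝ E]

/-- The chart metric at `u` as a map from `E` to its dual. -/
noncomputable def coordMetric (p : M) (u : E) : E →L[ℝ] E →L[ℝ] ℝ :=
  let A := mfderiv 𝓘(ℝ, E) 𝓘(ℝ, E) (extChartAt 𝓘(ℝ, E) p).symm u
  LinearMap.toContinuousLinearMap
    ((LinearMap.toContinuousLinearMap : (E →ₗ[ℝ] ℝ) ≃ₗ[ℝ] (E →L[ℝ] ℝ)).toLinearMap ∘ₗ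
      LinearMap.mk₂ ℝ (chartMetric p u)
        (fun v v' w => (congrArg (fun a => inner ℝ a (A w)) (map_add A v v')).trans
          (inner_add_left _ _ _))
        (fun c v w => (congrArg (fun a => inner ℝ a (A w)) (map_smul A c v)).trans
          (real_inner_smul_left _ _ _))
        (fun v w w' => (congrArg (fun a => inner ℝ (A v) a) (map_add A w w')).trans
          (inner_add_right _ _ _))
        (fun c v w => (congrArg (fun a => inner ℝ (A v) a) (map_smul A c w)).trans
          (real_inner_smul_right _ _ _)))

/-- The Christoffel symbols of the first kind on the diagonal, as the covector `ξ ↦ Γ_u(v, v; ξ)`.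
The two terms `∂_v g(v, ξ)` of `christoffelFirst` are written as the derivative of the covector
`g(v, ·)`, which makes linearity in `ξ` hold at every `u`; agreement with `christoffelFirst` needs `u`
in the chart target, where the metric is differentiable. -/
noncomputable def coordChristoffel (p : M) (u v : E) : E →L[ℝ] ℝ :=
  fderiv ℝ (fun u' => coordMetric p u' v) u v
    - (2⁻¹ : ℝ) • fderiv ℝ (fun u' => chartMetric p u' v v) u

@[simp]
theorem coordMetric_apply (p : M) (u v w : E) : coordMetric p u v w = chartMetric p u v w := rfl

theorem coordMetric_injective [IsManifold 𝓘(ℝ, E) ∞ M] (p : M) {u : E}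
    (hu : u ∈ (extChartAt 𝓘(ℝ, E) p).target) : Function.Injective (coordMetric p u) := by
  have : IsManifold 𝓘(ℝ, E) 1 M := IsManifold.of_le (n := ∞) (by norm_cast)
  refine (injective_iff_map_eq_zero _).2 fun v hv => ?_
  have h0 : chartMetric p u v v = 0 := by rw [← coordMetric_apply, hv]; rfl
  have hinv := isInvertible_mfderivWithin_extChartAt_symm hu
  rw [ModelWithCorners.range_eq_univ, mfderivWithin_univ] at hinv
  exact (injective_iff_map_eq_zero _).1 hinv.injective v (inner_self_eq_zero.1 h0)

variable [IsManifold 𝓘(ℝ, E) ∞ M]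
  [IsContMDiffRiemannianBundle 𝓘(ℝ, E) ∞ E (fun x : M => TangentSpace 𝓘(ℝ, E) x)]

theorem contDiffOn_coordMetric (p : M) :
    ContDiffOn ℝ ∞ (coordMetric p) (extChartAt 𝓘(ℝ, E) p).target :=
  contDiffOn_clm_apply.2 fun v => contDiffOn_clm_apply.2 fun w => contDiffOn_chartMetric p v w

theorem fderiv_coordMetric_apply (p : M) {u : E} (hu : u ∈ (extChartAt 𝓘(ℝ, E) p).target)
    (v w d : E) : fderiv ℝ (fun u' => coordMetric p u' v) u d w
      = fderiv ℝ (fun u' => chartMetric p u' v w) u d := by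
  have hd : DifferentiableAt ℝ (fun u' => coordMetric p u' v) u :=
    (((contDiffOn_coordMetric p).contDiffAt
      ((isOpen_extChartAt_target p).mem_nhds hu)).clm_apply
        contDiffAt_const).differentiableAt (by simp)
  have h := ((ContinuousLinearMap.apply ℝ ℝ w).hasFDerivAt.comp u hd.hasFDerivAt).fderiv
  exact (DFunLike.congr_fun h d).symm

theorem christoffelFirst_self (p : M) {u : E} (hu : u ∈ (extChartAt 𝓘(ℝ, E) p).target)
    (v ξ : E) : christoffelFirst p u v v ξ = coordChristoffel p u v ξ := by
  simp only [christoffelFirst, coordChristoffel, sub_apply, smul_apply,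
    fderiv_coordMetric_apply p hu, smul_eq_mul]
  ring

theorem contDiffOn_coordChristoffel (p : M) (ξ : E) :
    ContDiffOn ℝ ∞ (fun q : E × E => coordChristoffel p q.1 q.2 ξ)
      ((extChartAt 𝓘(ℝ, E) p).target ×ˢ univ) := by
  have key : ∀ (a b d : E × E → E), ContDiff ℝ ∞ a → ContDiff ℝ ∞ b → ContDiff ℝ ∞ d →
      ContDiffOn ℝ ∞ (fun q : E × E => fderiv ℝ (fun u' => chartMetric p u' (a q) (b q)) q.1 (d q))
        ((extChartAt 𝓘(ℝ, E) p).target ×ˢ univ) := by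
    intro a b d ha hb hd q hq
    have hG : ContDiffAt ℝ ∞ (fun r : (E × E) × E => coordMetric p r.2) (q, q.1) :=
      ContDiffAt.comp (g := coordMetric p) (q, q.1) ((contDiffOn_coordMetric p).contDiffAt
        ((isOpen_extChartAt_target p).mem_nhds hq.1)) contDiffAt_snd
    have hf : ContDiffAt ℝ ∞
        (Function.uncurry fun (q : E × E) (u' : E) => chartMetric p u' (a q) (b q)) (q, q.1) :=
      (hG.clm_apply (ha.comp contDiff_fst).contDiffAt).clm_apply
        (hb.comp contDiff_fst).contDiffAt
    exact ((hf.fderiv (m := ∞) contDiffAt_fst (by simp)).clm_apply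
      hd.contDiffAt).contDiffWithinAt
  refine ((key Prod.snd (fun _ => ξ) Prod.snd contDiff_snd contDiff_const contDiff_snd).sub
    ((key Prod.snd Prod.snd (fun _ => ξ) contDiff_snd contDiff_snd
      contDiff_const).const_smul (2⁻¹ : ℝ))).congr fun q hq => ?_
  simp only [coordChristoffel, sub_apply, smul_apply, fderiv_coordMetric_apply p hq.1]

end ChartMetric

/-! ### Initial velocities -/

section Velocity

variable {E : Type*} [NormedAddCommGroup E] [NormedSpace ℝ E]
  {M : Type*} [EMetricSpace M] [ChartedSpace E M]

/-- The coordinate velocity depends only on the velocity as a point of the tangent bundle. -/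
theorem deriv_extChartAt_comp [IsManifold 𝓘(ℝ, E) ∞ M] {γ : ℝ → M} {t₀ : ℝ}
    (hγ : ContMDiffAt 𝓘(ℝ, ℝ) 𝓘(ℝ, E) ∞ γ t₀) {p : M}
    (hp : γ t₀ ∈ (chartAt E p).source) :
    deriv (fun s => extChartAt 𝓘(ℝ, E) p (γ s)) t₀
      = (tangentMap 𝓘(ℝ, E) 𝓘(ℝ, E) (extChartAt 𝓘(ℝ, E) p) (velocity (E := E) γ t₀)).2 := by
  have hc : ContMDiffAt 𝓘(ℝ, E) 𝓘(ℝ, E) ∞ (extChartAt 𝓘(ℝ, E) p) (γ t₀) :=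
    contMDiffAt_extChartAt' hp
  have h := mfderiv_comp t₀ (hc.mdifferentiableAt (by simp)) (hγ.mdifferentiableAt (by simp))
  rw [mfderiv_eq_fderiv] at h
  exact congrArg (fun A : ℝ →L[ℝ] E => A 1) h

variable [RiemannianBundle (fun x : M => TangentSpace 𝓘(ℝ, E) x)]

theorem exists_geodesic_velocity_eq_logMap {Ω : Set M}
    (hΩ : IsGeodesicallyUniquelyConvex E Ω) {x y : M} (hx : x ∈ Ω) (hy : y ∈ Ω) :
    ∃ γ : ℝ → M, IsUnitGeodesic (E := E) γ ∧ velocity (E := E) γ 0 = ⟨x, logMap Ω x y⟩ ∧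
      γ 1 = y ∧ MapsTo γ (Icc 0 1) Ω := by
  obtain ⟨⟨γ, hγ, rfl, h1, hmap⟩, -⟩ := hΩ x hx y hy
  have h : ∃ v : TangentSpace 𝓘(ℝ, E) (γ 0), ∃ γ' : ℝ → M, IsUnitGeodesic (E := E) γ' ∧
      velocity (E := E) γ' 0 = ⟨γ 0, v⟩ ∧ γ' 1 = y ∧ MapsTo γ' (Icc 0 1) Ω :=
    ⟨_, γ, hγ, rfl, h1, hmap⟩
  rw [logMap, dif_pos h]
  exact h.choose_spec

end Velocity

/-! ### Uniqueness of geodesics -/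

section Geodesic

variable {E : Type*} [NormedAddCommGroup E] [NormedSpace ℝ E] [FiniteDimensional ℝ E]
  {M : Type*} [EMetricSpace M] [ChartedSpace E M] [IsManifold 𝓘(ℝ, E) ∞ M]
  [RiemannianBundle (fun x : M => TangentSpace 𝓘(ℝ, E) x)]
  [IsContMDiffRiemannianBundle 𝓘(ℝ, E) ∞ E (fun x : M => TangentSpace 𝓘(ℝ, E) x)]

/-- Two geodesics through the same point with the same coordinate velocity agree near that time. The
equations for both are written in the same chart, the one at the common point. -/
theorem IsGeodesicAt.eventuallyEq {γ₁ γ₂ : ℝ → M} {t₀ : ℝ}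
    (h₁ : IsGeodesicAt (E := E) γ₁ t₀) (h₂ : IsGeodesicAt (E := E) γ₂ t₀)
    (h0 : γ₁ t₀ = γ₂ t₀)
    (h0' : deriv (fun s => extChartAt 𝓘(ℝ, E) (γ₁ t₀) (γ₁ s)) t₀
      = deriv (fun s => extChartAt 𝓘(ℝ, E) (γ₁ t₀) (γ₂ s)) t₀) :
    γ₁ =ᶠ[𝓝 t₀] γ₂ := by
  obtain ⟨hs₁, he₁⟩ := h₁
  obtain ⟨hs₂, he₂⟩ := h₂
  rw [← h0] at he₂
  generalize hp : γ₁ t₀ = p at *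
  have key : ∀ γ : ℝ → M, ContMDiffAt 𝓘(ℝ, ℝ) 𝓘(ℝ, E) ∞ γ t₀ → γ t₀ = p →
      (∀ᶠ t in 𝓝 t₀, γ t ∈ (extChartAt 𝓘(ℝ, E) p).source) ∧
      ContDiffAt ℝ 2 (fun s => extChartAt 𝓘(ℝ, E) p (γ s)) t₀ := by
    intro γ hγ hγp
    constructor
    · refine hγ.continuousAt.eventually_mem ?_
      rw [hγp]
      exact extChartAt_source_mem_nhds p
    · have hc : ContMDiffAt 𝓘(ℝ, E) 𝓘(ℝ, E) ∞ (extChartAt 𝓘(ℝ, E) p) (γ t₀) := by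
        rw [hγp]; exact contMDiffAt_extChartAt
      exact (hc.comp t₀ hγ).contDiffAt.of_le (by norm_cast)
  obtain ⟨hsrc₁, hcd₁⟩ := key γ₁ hs₁ hp
  obtain ⟨hsrc₂, hcd₂⟩ := key γ₂ hs₂ h0.symm
  have hode : ∀ γ : ℝ → M, (∀ᶠ t in 𝓝 t₀, γ t ∈ (extChartAt 𝓘(ℝ, E) p).source) →
      (∀ᶠ t in 𝓝 t₀, ∀ ξ : E,
        let c : ℝ → E := fun s => extChartAt 𝓘(ℝ, E) p (γ s)
        chartMetric p (c t) (deriv (deriv c) t) ξ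
          + christoffelFirst p (c t) (deriv c t) (deriv c t) ξ = 0) →
      ∀ᶠ t in 𝓝 t₀, ∀ ξ : E,
        coordMetric p (extChartAt 𝓘(ℝ, E) p (γ t))
            (deriv (deriv fun s => extChartAt 𝓘(ℝ, E) p (γ s)) t) ξ
          + coordChristoffel p (extChartAt 𝓘(ℝ, E) p (γ t))
            (deriv (fun s => extChartAt 𝓘(ℝ, E) p (γ s)) t) ξ = 0 := by
    intro γ hsrc he
    filter_upwards [hsrc, he] with t hst ht ξ
    rw [coordMetric_apply, ← christoffelFirst_self p ((extChartAt 𝓘(ℝ, E) p).map_source hst)]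
    exact ht ξ
  have hcc := eventuallyEq_of_implicit_second_order (isOpen_extChartAt_target p)
    (contDiffOn_coordMetric p) (fun u hu => coordMetric_injective p hu)
    (contDiffOn_coordChristoffel p) hcd₁ hcd₂ (hode γ₁ hsrc₁ he₁) (hode γ₂ hsrc₂ he₂)
    ((extChartAt 𝓘(ℝ, E) p).map_source hsrc₁.self_of_nhds) (by rw [hp, h0]) h0'
  filter_upwards [hcc, hsrc₁, hsrc₂] with t ht ht₁ ht₂
  exact (extChartAt 𝓘(ℝ, E) p).injOn ht₁ ht₂ ht

/-- A geodesic on `[0, 1]` is determined by its initial velocity. -/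
theorem IsUnitGeodesic.eqOn {γ₁ γ₂ : ℝ → M} (h₁ : IsUnitGeodesic (E := E) γ₁)
    (h₂ : IsUnitGeodesic (E := E) γ₂)
    (hv : velocity (E := E) γ₁ 0 = velocity (E := E) γ₂ 0) : EqOn γ₁ γ₂ (Icc 0 1) := by
  let S : Set ℝ := {t | γ₁ =ᶠ[𝓝 t] γ₂}
  have hS : IsOpen S := isOpen_setOfPred_eventually_nhds
  have h0 : (0 : ℝ) ∈ S := by
    have hz : (0 : ℝ) ∈ Icc (0 : ℝ) 1 := by simp
    have hpos : γ₁ 0 = γ₂ 0 := congrArg TotalSpace.proj hv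
    refine (h₁ 0 hz).eventuallyEq (h₂ 0 hz) hpos ?_
    rw [deriv_extChartAt_comp (h₁ 0 hz).1 (mem_chart_source E _),
      deriv_extChartAt_comp (h₂ 0 hz).1 (by rw [hpos]; exact mem_chart_source E _), hv]
  -- Positions and coordinate velocities are continuous, so they still agree at limit times.
  have hcl : ∀ t ∈ Icc (0 : ℝ) 1, t ∈ closure S → t ∈ S := by
    intro t ht htS
    have hf : ∃ᶠ s in 𝓝 t, γ₁ =ᶠ[𝓝 s] γ₂ := mem_closure_iff_frequently.1 htS
    have hpos : γ₁ t = γ₂ t := by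
      by_contra hne
      have := ((h₁ t ht).1.continuousAt.prodMk (h₂ t ht).1.continuousAt).eventually
        (isClosed_diagonal.isOpen_compl.mem_nhds (by simpa using hne))
      obtain ⟨s, hs, hs'⟩ := (hf.and_eventually this).exists
      exact hs' hs.self_of_nhds
    refine (h₁ t ht).eventuallyEq (h₂ t ht) hpos ?_
    have hcont : ∀ γ : ℝ → M, ContMDiffAt 𝓘(ℝ, ℝ) 𝓘(ℝ, E) ∞ γ t → γ t = γ₁ t →
        ContinuousAt (deriv fun s => extChartAt 𝓘(ℝ, E) (γ₁ t) (γ s)) t := by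
      intro γ hγ hγp
      have hc : ContMDiffAt 𝓘(ℝ, E) 𝓘(ℝ, E) ∞ (extChartAt 𝓘(ℝ, E) (γ₁ t)) (γ t) := by
        rw [hγp]; exact contMDiffAt_extChartAt
      have hcd : ContDiffAt ℝ ∞ (fun s => extChartAt 𝓘(ℝ, E) (γ₁ t) (γ s)) t :=
        (hc.comp t hγ).contDiffAt
      exact (hcd.continuousAt_fderiv (by simp)).clm_apply continuousAt_const
    by_contra hne
    have := ((hcont γ₁ (h₁ t ht).1 rfl).prodMk (hcont γ₂ (h₂ t ht).1 hpos.symm)).eventually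
      (isClosed_diagonal.isOpen_compl.mem_nhds (by simpa using hne))
    obtain ⟨s, hs, hs'⟩ := (hf.and_eventually this).exists
    exact hs' (hs.fun_comp (extChartAt 𝓘(ℝ, E) (γ₁ t))).deriv_eq
  have hsub : Icc (0 : ℝ) 1 ⊆ S :=
    isPreconnected_Icc.subset_of_closure_inter_subset hS ⟨0, by simp, h0⟩
      fun t ht => hcl t ht.2 ht.1
  exact fun t ht => (hsub ht).self_of_nhds

/-- The value of `expMap` does not depend on the geodesic chosen in its definition. -/
theorem expMap_eq {x : M} {v : TangentSpace 𝓘(ℝ, E) x} {γ : ℝ → M}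
    (hγ : IsUnitGeodesic (E := E) γ) (hv : velocity (E := E) γ 0 = ⟨x, v⟩) :
    expMap x v = γ 1 := by
  have h : ∃ γ : ℝ → M, IsUnitGeodesic (E := E) γ ∧ velocity (E := E) γ 0 = ⟨x, v⟩ := ⟨γ, hγ, hv⟩
  rw [expMap, dif_pos h]
  exact h.choose_spec.1.eqOn hγ (h.choose_spec.2.trans hv.symm) (by simp)

end Geodesic
end RiemProx

theorem lemma3p2
    {E : Type*} [NormedAddCommGroup E] [NormedSpace ℝ E] [FiniteDimensional ℝ E]
    {M : Type*} [EMetricSpace M] [ChartedSpace E M] [IsManifold 𝓘(ℝ, E) ∞ M]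
    [RiemannianBundle (fun x : M => TangentSpace 𝓘(ℝ, E) x)]
    [IsContMDiffRiemannianBundle 𝓘(ℝ, E) ∞ E (fun x : M => TangentSpace 𝓘(ℝ, E) x)]
    [IsRiemannianManifold 𝓘(ℝ, E) M]
    (Ω : Set M) (hΩ : RiemProx.IsGeodesicallyUniquelyConvex E Ω)
    (f h : M → ℝ) (L μ ρ θ : ℝ) (hL : 0 < L) (hμ : 0 ≤ μ) (hθ : 1 ≤ θ)
    (hf : ∀ x ∈ Ω, MDifferentiableAt 𝓘(ℝ, E) 𝓘(ℝ, ℝ) f x)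
    (hfL : RiemProx.IsGeodesicallySmooth E L f Ω)
    (hfμ : RiemProx.IsGeodesicallyStronglyConvex E μ f Ω)
    (hh : RiemProx.IsLocallyLipschitzIn h Ω)
    (hhρ : RiemProx.IsRetractionConvex (E := E) RiemProx.expMap (RiemProx.expDomain Ω) ρ h Ω)
    (y : M) (hy : y ∈ Ω) (η : TangentSpace 𝓘(ℝ, E) y)
    (hstat : (0 : TangentSpace 𝓘(ℝ, E) y) ∈
      RiemProx.clarkeSubdiff (RiemProx.proxModel θ L f h y) η)
    (hle : RiemProx.proxModel θ L f h y η ≤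
      RiemProx.proxModel θ L f h y (0 : TangentSpace 𝓘(ℝ, E) y))
    (z : M) (hz : z ∈ Ω) (hzexp : z = RiemProx.expMap y η)
    (hzlog : RiemProx.logMap Ω y z = η)
    (x : M) (hx : x ∈ Ω) :
    (θ * L - ρ) / 2 * ‖RiemProx.logMap Ω y x - η‖ ^ 2
        - (θ * L - μ) / 2 * ‖RiemProx.logMap (E := E) Ω y x‖ ^ 2
      ≤ (f x + h x) - (f z + h z) := by
  obtain ⟨γx, hγx, hvx, hx1, hmx⟩ := RiemProx.exists_geodesic_velocity_eq_logMap hΩ hy hx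
  obtain ⟨γz, hγz, hvz, -, hmz⟩ := RiemProx.exists_geodesic_velocity_eq_logMap hΩ hy hz
  have hsmooth := hfL y hy z hz
  have hconv := hfμ y hy x hx
  rw [hzlog] at hvz hsmooth
  have hxexp : RiemProx.expMap y (RiemProx.logMap (E := E) Ω y x) = x :=
    (RiemProx.expMap_eq hγx hvx).trans hx1
  set ξ : TangentSpace 𝓘(ℝ, E) y := RiemProx.logMap Ω y x with hξ
  -- Two tangent vectors suffice: the subgradient is taken at `η` and tested at `ξ`.
  have hsub := hhρ y hy {ξ, η}
    (by rintro ζ (rfl | rfl)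
        exacts [⟨γx, hγx, hvx, hmx⟩, ⟨γz, hγz, hvz, hmz⟩])
    (by rintro ζ (rfl | rfl)
        exacts [hxexp.symm ▸ hx, hzexp ▸ hz])
    ξ (by simp) η (by simp) _ (RiemProx.neg_add_smul_mem_clarkeSubdiff (ρ := ρ) hstat)
  rw [hxexp, ← hzexp, inner_neg_left, inner_add_left, real_inner_smul_left, inner_sub_right,
    inner_sub_right, real_inner_self_eq_norm_sq, real_inner_comm ξ η] at hsub
  have hmaj := (abs_le.1 hsmooth).2
  rw [norm_sub_sq_real]
  have hslack : 0 ≤ (θ - 1) * L * ‖η‖ ^ 2 :=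
    mul_nonneg (mul_nonneg (sub_nonneg.2 hθ) hL.le) (sq_nonneg _)
  linarith
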